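/- **Setting.** Let $\Sigma$ be a first-order language with equality whose predicate symbols are either ordinary or inductive, and let $\Phi$ be a finite set of axioms $\bigwedge_m Q_m(\overline u_m)\wedge\bigwedge_m P_m(\overline t_m)\Rightarrow P(\overline t)$ with $Q_m$ ordinary and $P_m,P$ inductive. A *standard model* $M$ of $(\Sigma,\Phi)$ is a $\Sigma$-structure in which the inductive symbols are interpreted by the least prefixed point of the monotone operator given by $\Phi$. A sequent $\Gamma\vdash\Delta$ is a pair of finite multisets of formulas; it is *true* in $M$ if under every valuation that satisfies all of $\Gamma$ some formula of $\Delta$ holds. An *inductive antecedent atom* (IAA) of $\Gamma\vdash\Delta$ is an atom with an inductive predicate symbol in $\Gamma$. The system $\mathrm{CLKID}^\omega_N$ consists of Gentzen's LK rules (with $(Ax)$, $(Wk)$, contraction, $(Cut)$, and $(Subst)$, which infers $\Gamma[\theta]\vdash\Delta[\theta]$ from $\Gamma\vdash\Delta$), the axiom $\Gamma\vdash t=t,\Delta$, the rule $(Gen)$, which infers $\Gamma,x=u\vdash\Delta$ from $\Gamma[\{x\mapsto u\}]\vdash\Delta[\{x\mapsto u\}]$ for a variable $x$ not occurring in $u$,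 unfolding of an inductive atom on the right by an (instance of an) axiom of $\Phi$, and $(Case)$, which infers $\Gamma,P(\overline t')\vdash\Delta$ from the case distinctions $\Gamma,\overline t'=\overline t,Q_1(\overline u_1),\dots,Q_h(\overline u_h),P_1(\overline t_1),\dots,P_l(\overline t_l)\vdash\Delta$, one for each axiom for $P$ (with its variables renamed to new ones); $P_1(\overline t_1),\dots,P_l(\overline t_l)$ are the case descendants of $P(\overline t')$. A *pre-proof tree-set* is a finite set of finite derivation trees in which each terminal node is either the conclusion of a rule without premises or a *bud*; each bud is assigned a *companion*, a node of the tree-set with the same sequent. The usual eigenvariable convention is in force: the variables introduced by $(\forall R)$, $(\exists L)$ and $(Case)$ are not free in any sequent between the root of the tree and the conclusion of the rule. The tree-set is *normalised* if every companion is a root, every bud is the premise of a $(Subst)$ step, and every premise of a $(Subst)$ step is a terminal node. Its *digraph* has the nodes as vertices, an arrow from each node to each of its premises, and an arrow from each bud to its companion. $S(N)$ is the sequent of the node $N$. An *rb-path* is a path $[R,\dots,H,B]$ from a root $R$ to a bud $B$ of the same tree that contains no other bud; its *cumulative substitution* $\theta^c$ is the composition, in order along $[R,\dots,H]$, of the substitutions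 $\{x\mapsto u\}$ of the $(Gen)$ steps with principal formula $x=u$ (the other steps contribute the identity). A *trace* following a path of premises chooses an IAA $\tau_i$ of each node so that $\tau_{i+1}=\tau_i$ at each step, except that $\tau_{i+1}=\tau_i[\{x\mapsto u\}]$ at a $(Gen)$ step, $\tau_i=\tau_{i+1}[\theta]$ at a $(Subst)$ step, and $\tau_{i+1}$ is a case descendant of $\tau_i$ at a $(Case)$ step with principal formula $\tau_i$. Let $\pi$ be a strongly connected component (SCC) of the digraph, $<_a$ a strict partial ordering, stable under substitutions, on the instances of IAAs of the sequents of nodes in $\pi$, and $<_\pi$ its multiset extension. Let $A$ be a *measure*: it assigns to every sequent $S$ a multiset $A_S$ of IAAs of $S$, and $A_{S[\sigma]}=A_S[\sigma]$ for all root sequents $S$ of $\pi$ and all substitutions $\sigma$. For an rb-path $p=[R,\dots,H,B]$ put $E=A_{S(R)[\theta^c]}$, $C=A_{S(H)}$, and let $E'=E\setminus C$, $C'=C\setminus E$ be what remains after pairwise deletion of common elements. An element $l$ of $C$ *derives from* an element $l'$ of $E$ if some trace following $[R,\dots,H]$ starts with an atom $\tau$ with $\tau[\theta^c]\equiv l'$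 and ends with $l$. Then $S(H)$ is *$<_\pi$-derivable* from $S(R)[\theta^c]$ along $p$ if (i) $C<_\pi E$; (ii) each $l\in C\setminus C'$ is the unique element of $C$ that derives from some $l'\in E\setminus E'$ with $l'\equiv l$; (iii) each $l\in C'$ derives from some $l'\in E'$ with $l<_a l'$. The SCC $\pi$ *discharges its induction hypotheses* if, for some such $<_a$ and $A$, for every rb-path $[R,\dots,H,B]$ in $\pi$ the sequent $S(H)$ is $<_\pi$-derivable from $S(R)[\theta^c]$ along it. **Theorem (soundness).** If every non-singleton strongly connected component of the digraph of a normalised $\mathrm{CLKID}^\omega_N$ pre-proof tree-set discharges its induction hypotheses, then every sequent labelling a root of the tree-set is true in every standard model of $(\Sigma,\Phi)$. -/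

import Mathlib

universe u v w x

namespace CLKID

open FirstOrder FirstOrder.Language

/-! ### Syntax: variables are the natural numbers, formulas are Mathlib's first-order formulas -/

/-- Substitutions of terms for the variables. (A substitution with finite support is
one that is the identity outside a finite set; on a given sequent there is no difference.) -/
abbrev Subst (L : FirstOrder.Language.{u, v}) := ℕ → L.Term ℕ

/-- The identity substitution. -/
def Subst.id (L : FirstOrder.Language.{u, v}) : Subst L := fun y => Term.var y

/-- The substitution `{y ↦ t}`. -/
def Subst.single {L : FirstOrder.Language.{u, v}} (y : ℕ) (t : L.Term ℕ) : Subst L :=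
  fun z => if z = y then t else Term.var z

/-- The composition `σ₁σ₂`: first `σ₁`, then `σ₂`. -/
def Subst.comp {L : FirstOrder.Language.{u, v}} (σ₁ σ₂ : Subst L) : Subst L := fun y => (σ₁ y).subst σ₂

/-- The instance `F[t]` of a formula `F` with one bound variable open. -/
def openAt {L : FirstOrder.Language.{u, v}} (F : L.BoundedFormula ℕ 1) (t : L.Term ℕ) : L.Formula ℕ :=
  BoundedFormula.subst F.toFormula (Sum.elim (fun y => Term.var y) (fun _ => t))

/-- Atoms `P(t₁, …, tₙ)` for a predicate symbol `P`; equations are not atoms in this sense. -/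
structure Atom (L : FirstOrder.Language.{u, v}) where
  sym : Σ n, L.Relations n
  args : Fin sym.1 → L.Term ℕ

namespace Atom

variable {L : FirstOrder.Language.{u, v}}

def subst (a : Atom L) (σ : Subst L) : Atom L := ⟨a.sym, fun i => (a.args i).subst σ⟩

def toFormula (a : Atom L) : L.Formula ℕ := Relations.formula a.sym.2 a.args

def vars (a : Atom L) : Set ℕ := {y | ∃ i, y ∈ (a.args i).varFinset}

end Atom

/-- Sequents `Γ ⊢ Δ`, with multisets of formulas. -/
@[ext] structure Sequent (L : FirstOrder.Language.{u, v}) where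
  ant : Multiset (L.Formula ℕ)
  suc : Multiset (L.Formula ℕ)

namespace Sequent

variable {L : FirstOrder.Language.{u, v}}

def subst (S : Sequent L) (σ : Subst L) : Sequent L :=
  ⟨S.ant.map (fun F => BoundedFormula.subst F σ), S.suc.map (fun F => BoundedFormula.subst F σ)⟩

/-- The free variables of a sequent. -/
def FV (S : Sequent L) : Set ℕ :=
  {y | ∃ F : L.Formula ℕ, (F ∈ S.ant ∨ F ∈ S.suc) ∧ y ∈ BoundedFormula.freeVarFinset F}

end Sequent

/-! ### Inductive definitions and standard models -/

/-- An axiom `Q₁(u₁) ∧ … ∧ Q_h(u_h) ∧ P₁(t₁) ∧ … ∧ P_l(t_l) ⇒ P(t)`. -/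
structure Production (L : FirstOrder.Language.{u, v}) where
  ords : List (Atom L)
  inds : List (Atom L)
  head : Atom L

def Production.vars {L : FirstOrder.Language.{u, v}} (c : Production L) : Set ℕ :=
  {y | (∃ a ∈ c.ords, y ∈ a.vars) ∨ (∃ a ∈ c.inds, y ∈ a.vars) ∨ y ∈ c.head.vars}

/-- A specification: which predicate symbols are inductive (the others are ordinary), and the
finite inductive definition set of axioms. -/
structure Spec (L : FirstOrder.Language.{u, v}) where
  ind : Set (Σ n, L.Relations n)
  prods : List (Production L)
  ords_ordinary : ∀ c ∈ prods, ∀ a ∈ c.ords, a.sym ∉ ind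
  inds_inductive : ∀ c ∈ prods, ∀ a ∈ c.inds, a.sym ∈ ind
  head_inductive : ∀ c ∈ prods, c.head.sym ∈ ind

/-- A predicate symbol together with a tuple of elements of `M`. -/
abbrev GroundAtom (L : FirstOrder.Language.{u, v}) (M : Type w) := Σ p : (Σ n, L.Relations n), (Fin p.1 → M)

def Atom.eval {L : FirstOrder.Language.{u, v}} {M : Type w} [L.Structure M] (a : Atom L) (ρ : ℕ → M) :
    GroundAtom L M :=
  ⟨a.sym, fun i => (a.args i).realize ρ⟩

namespace Spec

variable {L : FirstOrder.Language.{u, v}}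

/-- The monotone operator of the inductive definition set on families of relations over `M`. -/
def operator (Sp : Spec L) (M : Type w) [L.Structure M] :
    Set (GroundAtom L M) →o Set (GroundAtom L M) where
  toFun X := {g | ∃ c ∈ Sp.prods, ∃ ρ : ℕ → M, c.head.eval ρ = g ∧
    (∀ a ∈ c.ords, a.toFormula.Realize ρ) ∧ (∀ a ∈ c.inds, a.eval ρ ∈ X)}
  monotone' := by
    rintro X Y hXY g ⟨c, hc, ρ, hg, ho, hi⟩
    exact ⟨c, hc, ρ, hg, ho, fun a ha => hXY (hi a ha)⟩

/-- `M` is a standard model: the inductive predicate symbols are interpreted by the least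
prefixed point of the operator. -/
def IsStandardModel (Sp : Spec L) (M : Type w) [L.Structure M] : Prop :=
  ∀ p ∈ Sp.ind, ∀ xs : Fin p.1 → M,
    FirstOrder.Language.Structure.RelMap p.2 xs ↔
      (⟨p, xs⟩ : GroundAtom L M) ∈ OrderHom.lfp (Sp.operator M)

open Classical in
/-- The axioms that define the predicate symbol of the atom `p`. -/
noncomputable def prodsFor (Sp : Spec L) (p : Atom L) : List (Production L) :=
  Sp.prods.filter (fun c => decide (c.head.sym = p.sym))

end Spec

/-- `S` is true in `M`. -/
def Sequent.IsTrue {L : FirstOrder.Language.{u, v}} (S : Sequent L) (M : Type w) [L.Structure M] : Prop :=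
  ∀ ρ : ℕ → M, (∀ G ∈ S.ant, G.Realize ρ) → ∃ D ∈ S.suc, D.Realize ρ

/-- `a` is an inductive antecedent atom (IAA) of `S`. -/
def IsIAA {L : FirstOrder.Language.{u, v}} (Sp : Spec L) (S : Sequent L) (a : Atom L) : Prop :=
  a.sym ∈ Sp.ind ∧ a.toFormula ∈ S.ant

/-! ### The inference system CLKID^ω_N -/

/-- Renaming of the variables of a production, as a substitution. -/
def ren {L : FirstOrder.Language.{u, v}} (r : ℕ → ℕ) : Subst L := fun y => Term.var (r y)

/-- The case distinction `Γ, t' = t, Q₁(u₁), …, P₁(t₁), … ⊢ Δ` of the atom `p = P(t')` for the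
axiom `c`, whose variables are renamed by `r`. -/
def caseDistinction {L : FirstOrder.Language.{u, v}} (Γ Δ : Multiset (L.Formula ℕ)) (p : Atom L)
    (c : Production L) (r : ℕ → ℕ) : Sequent L :=
  ⟨Γ + ((List.zipWith Term.equal (List.ofFn p.args) (List.ofFn (c.head.subst (ren r)).args) :
        List (L.Formula ℕ)) : Multiset (L.Formula ℕ))
      + ((c.ords.map (fun a => (a.subst (ren r)).toFormula) : List (L.Formula ℕ)) :
        Multiset (L.Formula ℕ))
      + ((c.inds.map (fun a => (a.subst (ren r)).toFormula) : List (L.Formula ℕ)) :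
        Multiset (L.Formula ℕ)), Δ⟩

/-- Instances of inference rules. `Γ`, `Δ` are the contexts. The connectives other than `⊥`, `→`,
`∀` are Mathlib's abbreviations. Conclusions, premises and side conditions follow below. -/
inductive RuleInst (L : FirstOrder.Language.{u, v})
  -- structural rules
  | ax (Γ Δ : Multiset (L.Formula ℕ)) (F : L.Formula ℕ)
  | wk (Γ Δ Γ' Δ' : Multiset (L.Formula ℕ))
  | contrL (Γ Δ : Multiset (L.Formula ℕ)) (F : L.Formula ℕ)
  | contrR (Γ Δ : Multiset (L.Formula ℕ)) (F : L.Formula ℕ)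
  | cut (Γ Δ : Multiset (L.Formula ℕ)) (F : L.Formula ℕ)
  | subst (Γ Δ : Multiset (L.Formula ℕ)) (θ : Subst L)
  -- logical rules
  | botL (Γ Δ : Multiset (L.Formula ℕ))
  | negL (Γ Δ : Multiset (L.Formula ℕ)) (F : L.Formula ℕ)
  | negR (Γ Δ : Multiset (L.Formula ℕ)) (F : L.Formula ℕ)
  | andL (Γ Δ : Multiset (L.Formula ℕ)) (F G : L.Formula ℕ)
  | andR (Γ Δ : Multiset (L.Formula ℕ)) (F G : L.Formula ℕ)
  | orL (Γ Δ : Multiset (L.Formula ℕ)) (F G : L.Formula ℕ)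
  | orR (Γ Δ : Multiset (L.Formula ℕ)) (F G : L.Formula ℕ)
  | impL (Γ Δ : Multiset (L.Formula ℕ)) (F G : L.Formula ℕ)
  | impR (Γ Δ : Multiset (L.Formula ℕ)) (F G : L.Formula ℕ)
  | allL (Γ Δ : Multiset (L.Formula ℕ)) (F : L.BoundedFormula ℕ 1) (t : L.Term ℕ)
  | allR (Γ Δ : Multiset (L.Formula ℕ)) (F : L.BoundedFormula ℕ 1) (y : ℕ)
  | exL (Γ Δ : Multiset (L.Formula ℕ)) (F : L.BoundedFormula ℕ 1) (y : ℕ)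
  | exR (Γ Δ : Multiset (L.Formula ℕ)) (F : L.BoundedFormula ℕ 1) (t : L.Term ℕ)
  -- equality rules
  | eqR (Γ Δ : Multiset (L.Formula ℕ)) (t : L.Term ℕ)
  | gen (Γ Δ : Multiset (L.Formula ℕ)) (y : ℕ) (t : L.Term ℕ)
  -- rules for inductive predicates
  | unfold (Γ Δ : Multiset (L.Formula ℕ)) (c : Production L) (σ : Subst L)
  | case (Γ Δ : Multiset (L.Formula ℕ)) (p : Atom L) (r : Production L → ℕ → ℕ)

namespace RuleInst

variable {L : FirstOrder.Language.{u, v}}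

/-- The conclusion (lower sequent) of a rule instance. -/
def concl : RuleInst L → Sequent L
  | ax Γ Δ F => ⟨F ::ₘ Γ, F ::ₘ Δ⟩
  | wk Γ Δ Γ' Δ' => ⟨Γ + Γ', Δ + Δ'⟩
  | contrL Γ Δ F => ⟨F ::ₘ Γ, Δ⟩
  | contrR Γ Δ F => ⟨Γ, F ::ₘ Δ⟩
  | cut Γ Δ _ => ⟨Γ, Δ⟩
  | subst Γ Δ θ => Sequent.subst ⟨Γ, Δ⟩ θ
  | botL Γ Δ => ⟨⊥ ::ₘ Γ, Δ⟩
  | negL Γ Δ F => ⟨BoundedFormula.not F ::ₘ Γ, Δ⟩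
  | negR Γ Δ F => ⟨Γ, BoundedFormula.not F ::ₘ Δ⟩
  | andL Γ Δ F G => ⟨(F ⊓ G) ::ₘ Γ, Δ⟩
  | andR Γ Δ F G => ⟨Γ, (F ⊓ G) ::ₘ Δ⟩
  | orL Γ Δ F G => ⟨(F ⊔ G) ::ₘ Γ, Δ⟩
  | orR Γ Δ F G => ⟨Γ, (F ⊔ G) ::ₘ Δ⟩
  | impL Γ Δ F G => ⟨BoundedFormula.imp F G ::ₘ Γ, Δ⟩
  | impR Γ Δ F G => ⟨Γ, BoundedFormula.imp F G ::ₘ Δ⟩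
  | allL Γ Δ F _ => ⟨F.all ::ₘ Γ, Δ⟩
  | allR Γ Δ F _ => ⟨Γ, F.all ::ₘ Δ⟩
  | exL Γ Δ F _ => ⟨F.ex ::ₘ Γ, Δ⟩
  | exR Γ Δ F _ => ⟨Γ, F.ex ::ₘ Δ⟩
  | eqR Γ Δ t => ⟨Γ, Term.equal t t ::ₘ Δ⟩
  | gen Γ Δ y t => ⟨Term.equal (Term.var y) t ::ₘ Γ, Δ⟩
  | unfold Γ Δ c σ => ⟨Γ, (c.head.subst σ).toFormula ::ₘ Δ⟩
  | case Γ Δ p _ => ⟨p.toFormula ::ₘ Γ, Δ⟩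

/-- The premises (upper sequents) of a rule instance. -/
noncomputable def prems (Sp : Spec L) : RuleInst L → List (Sequent L)
  | ax _ _ _ => []
  | wk Γ Δ _ _ => [⟨Γ, Δ⟩]
  | contrL Γ Δ F => [⟨F ::ₘ F ::ₘ Γ, Δ⟩]
  | contrR Γ Δ F => [⟨Γ, F ::ₘ F ::ₘ Δ⟩]
  | cut Γ Δ F => [⟨Γ, F ::ₘ Δ⟩, ⟨F ::ₘ Γ, Δ⟩]
  | subst Γ Δ _ => [⟨Γ, Δ⟩]
  | botL _ _ => []
  | negL Γ Δ F => [⟨Γ, F ::ₘ Δ⟩]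
  | negR Γ Δ F => [⟨F ::ₘ Γ, Δ⟩]
  | andL Γ Δ F G => [⟨F ::ₘ G ::ₘ Γ, Δ⟩]
  | andR Γ Δ F G => [⟨Γ, F ::ₘ Δ⟩, ⟨Γ, G ::ₘ Δ⟩]
  | orL Γ Δ F G => [⟨F ::ₘ Γ, Δ⟩, ⟨G ::ₘ Γ, Δ⟩]
  | orR Γ Δ F G => [⟨Γ, F ::ₘ G ::ₘ Δ⟩]
  | impL Γ Δ F G => [⟨Γ, F ::ₘ Δ⟩, ⟨G ::ₘ Γ, Δ⟩]
  | impR Γ Δ F G => [⟨F ::ₘ Γ, G ::ₘ Δ⟩]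
  | allL Γ Δ F t => [⟨openAt F t ::ₘ Γ, Δ⟩]
  | allR Γ Δ F y => [⟨Γ, openAt F (Term.var y) ::ₘ Δ⟩]
  | exL Γ Δ F y => [⟨openAt F (Term.var y) ::ₘ Γ, Δ⟩]
  | exR Γ Δ F t => [⟨Γ, openAt F t ::ₘ Δ⟩]
  | eqR _ _ _ => []
  | gen Γ Δ y t => [Sequent.subst ⟨Γ, Δ⟩ (Subst.single y t)]
  | unfold Γ Δ c σ =>
      c.ords.map (fun a => ⟨Γ, (a.subst σ).toFormula ::ₘ Δ⟩) ++
      c.inds.map (fun a => ⟨Γ, (a.subst σ).toFormula ::ₘ Δ⟩)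
  | case Γ Δ p r => (Sp.prodsFor p).map (fun c => caseDistinction Γ Δ p c (r c))

/-- The new (eigen-)variables introduced by a rule instance. -/
def eigen (Sp : Spec L) : RuleInst L → Set ℕ
  | allR _ _ _ y => {y}
  | exL _ _ _ y => {y}
  | case _ _ p r => {y | ∃ c ∈ Sp.prodsFor p, ∃ z ∈ c.vars, y = r c z}
  | _ => ∅

/-- The side conditions that are not about freshness of the eigenvariables. -/
def Side (Sp : Spec L) : RuleInst L → Prop
  | gen _ _ y t => y ∉ t.varFinset
  | unfold _ _ c _ => c ∈ Sp.prods
  | case _ _ p r => p.sym ∈ Sp.ind ∧ ∀ c ∈ Sp.prodsFor p, Set.InjOn (r c) c.vars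
  | _ => True

/-- A correct rule instance: the side conditions hold, and the eigenvariables are not free in the
conclusion. -/
def Ok (Sp : Spec L) (ρ : RuleInst L) : Prop :=
  ρ.Side Sp ∧ ∀ y ∈ ρ.eigen Sp, y ∉ ρ.concl.FV

def IsSubst : RuleInst L → Prop
  | subst _ _ _ => True
  | _ => False

/-- The substitution that annotates the forward arrows from a node to which the rule instance is
applied: `{y ↦ t}` for `(Gen)` with principal formula `y = t`, otherwise the identity
substitution. (The arrows of `(Subst)` are not annotated; they are never used.) -/
def annot : RuleInst L → Subst L
  | gen _ _ y t => Subst.single y t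
  | _ => Subst.id L

/-- One step of a trace, from an atom `a` of the conclusion to an atom `b` of premise number `k`
(it is required separately that they are IAAs of the two sequents). -/
def TraceStep (Sp : Spec L) (k : ℕ) (a b : Atom L) : RuleInst L → Prop
  | subst _ _ θ => a = b.subst θ
  | gen _ _ y t => b = a.subst (Subst.single y t)
  | case Γ _ p r =>
      (a.toFormula ∈ Γ ∧ b = a) ∨
      (a = p ∧ ∃ c, (Sp.prodsFor p)[k]? = some c ∧ ∃ d ∈ c.inds, b = d.subst (ren (r c)))
  | _ => b = a

end RuleInst

/-! ### Pre-proof tree-sets -/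

/-- What a node carries: the rule instance applied to it, or, for a bud, its companion. -/
inductive Just (L : FirstOrder.Language.{u, v}) (V : Type x)
  | rule (ρ : RuleInst L)
  | bud (companion : V)

/-- A pre-proof tree-set of CLKID^ω_N, with (finite) set of nodes `V`: a forest of derivation trees
in which every terminal node is the conclusion of a rule without premises or a bud, together with
the induction function that gives every bud a companion with the same sequent. -/
structure TreeSet {L : FirstOrder.Language.{u, v}} (Sp : Spec L) (V : Type x) where
  seq : V → Sequent L
  just : V → Just L V
  /-- the nodes of the premises, in order -/
  kids : V → List V
  kids_nodup : ∀ n, (kids n).Nodup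
  parent_unique : ∀ m n k, k ∈ kids m → k ∈ kids n → m = n
  acyclic : ∀ n, ¬ Relation.TransGen (fun a b => b ∈ kids a) n n
  rule_ok : ∀ n ρ, just n = Just.rule ρ →
    ρ.Ok Sp ∧ ρ.concl = seq n ∧ ρ.prems Sp = (kids n).map seq
  bud_ok : ∀ n c, just n = Just.bud c → kids n = [] ∧ seq c = seq n

namespace TreeSet

variable {L : FirstOrder.Language.{u, v}} {Sp : Spec L} {V : Type x}

/-- Forward arrows of the digraph. -/
def Child (T : TreeSet Sp V) (m n : V) : Prop := n ∈ T.kids m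

def IsRoot (T : TreeSet Sp V) (n : V) : Prop := ∀ m, ¬ T.Child m n

def IsBud (T : TreeSet Sp V) (n : V) : Prop := ∃ c, T.just n = Just.bud c

def IsSubstNode (T : TreeSet Sp V) (n : V) : Prop := ∃ ρ, T.just n = Just.rule ρ ∧ ρ.IsSubst

/-- Arrows of the digraph: forward arrows and back-links. -/
def Arrow (T : TreeSet Sp V) (m n : V) : Prop := T.Child m n ∨ T.just m = Just.bud n

/-- Eigenvariable convention: the variables introduced by a rule are new, i.e. they are not free
in any sequent between the root of the tree and the conclusion of the rule. -/
def EigenvariablesNew (T : TreeSet Sp V) : Prop :=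
  ∀ n ρ, T.just n = Just.rule ρ → ∀ m, Relation.ReflTransGen T.Child m n →
    ∀ y ∈ ρ.eigen Sp, y ∉ (T.seq m).FV

/-- Normal forms: companions are roots, each bud is a premise of `(Subst)`, and each premise of
`(Subst)` is a terminal node. -/
structure IsNormalised (T : TreeSet Sp V) : Prop where
  companion_root : ∀ b c, T.just b = Just.bud c → T.IsRoot c
  bud_subst : ∀ b, T.IsBud b → ∃ h, T.Child h b ∧ T.IsSubstNode h
  subst_terminal : ∀ h, T.IsSubstNode h → ∀ n, T.Child h n → T.kids n = []

/-- Strongly connected components of the digraph. -/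
def IsSCC (T : TreeSet Sp V) (π : Set V) : Prop :=
  ∃ n, π = {m | Relation.ReflTransGen T.Arrow n m ∧ Relation.ReflTransGen T.Arrow m n}

/-- `[R, …, H, B]` is an rb-path, where `p = [R, …, H]`. (Only buds have back-links, so the part
before the bud `B` follows forward arrows.) -/
def IsRbPath (T : TreeSet Sp V) (p : List V) (R H B : V) : Prop :=
  p.head? = some R ∧ p.getLast? = some H ∧ T.IsRoot R ∧ T.IsBud B ∧
    List.IsChain T.Child (p ++ [B])

/-- The substitution annotating the forward arrows that start from `n`. -/
def annot (T : TreeSet Sp V) (n : V) : Subst L :=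
  match T.just n with
  | Just.rule ρ => ρ.annot
  | Just.bud _ => Subst.id L

/-- The cumulative substitution: for `[N₁, …, Nₙ]` it is the composition `σ₁ ⋯ σₙ₋₁` of the
annotations of the arrows. (The overall identity substitution is a unit for composition, since
substitutions are total here.) -/
def cumulative (T : TreeSet Sp V) : List V → Subst L
  | [] => Subst.id L
  | [_] => Subst.id L
  | n :: m :: p => (T.annot n).comp (T.cumulative (m :: p))

/-- `TraceAlong T p a b`: some trace following the path `p` (of forward arrows) starts with the
IAA `a` of the first node and ends with the IAA `b` of the last node. -/
inductive TraceAlong (T : TreeSet Sp V) : List V → Atom L → Atom L → Prop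
  | single (n : V) (a : Atom L) (ha : IsIAA Sp (T.seq n) a) : TraceAlong T [n] a a
  | cons (n m : V) (p : List V) (ρ : RuleInst L) (k : ℕ) (a b c : Atom L)
      (ha : IsIAA Sp (T.seq n) a) (hρ : T.just n = Just.rule ρ)
      (hk : (T.kids n)[k]? = some m) (hstep : ρ.TraceStep Sp k a b)
      (h : TraceAlong T (m :: p) b c) : TraceAlong T (n :: m :: p) a c

/-- `l` derives from `l'` along `p`, where `l` is regarded as the instance with `δ` of an IAA of
the last node of `p`, and `l'` as the instance with `θ` of an IAA of the first one. -/
def DerivesFrom (T : TreeSet Sp V) (p : List V) (θ δ : Subst L) (l' l : Atom L) : Prop :=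
  ∃ a b, T.TraceAlong p a b ∧ a.subst θ = l' ∧ b.subst δ = l

end TreeSet

/-! ### Ordering and derivability conditions -/

/-- The multiset extension of a relation. -/
def MultisetExt {α : Type*} (lt : α → α → Prop) (A B : Multiset α) : Prop :=
  ∃ X Y Z : Multiset α, Z ≠ 0 ∧ A = X + Y ∧ B = X + Z ∧ ∀ y ∈ Y, ∃ z ∈ Z, lt y z

namespace TreeSet

variable {L : FirstOrder.Language.{u, v}} {Sp : Spec L} {V : Type x}

/-- The instances of the IAAs of the sequents labelling nodes in `π`. -/
def iaaInstances (T : TreeSet Sp V) (π : Set V) : Set (Atom L) :=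
  {l | ∃ n ∈ π, ∃ a, IsIAA Sp (T.seq n) a ∧ ∃ σ : Subst L, l = a.subst σ}

/-- `lt` is a (strict, partial) ordering over the instances of the IAAs of `π`, stable under
substitutions. -/
structure IsStableOrdering (T : TreeSet Sp V) (π : Set V) (lt : Atom L → Atom L → Prop) :
    Prop where
  irrefl : ∀ l ∈ T.iaaInstances π, ¬ lt l l
  trans : ∀ l₁ ∈ T.iaaInstances π, ∀ l₂ ∈ T.iaaInstances π, ∀ l₃ ∈ T.iaaInstances π,
    lt l₁ l₂ → lt l₂ l₃ → lt l₁ l₃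
  stable : ∀ l₁ ∈ T.iaaInstances π, ∀ l₂ ∈ T.iaaInstances π, ∀ σ : Subst L,
    lt l₁ l₂ → lt (l₁.subst σ) (l₂.subst σ)

/-- `A` associates with every sequent `S` a measure value, a multiset of IAAs of `S`, in such a
way that the measure of the instances of the root sequents of `π` is the instance of their
measure. -/
structure IsMeasure (T : TreeSet Sp V) (π : Set V) (A : Sequent L → Multiset (Atom L)) :
    Prop where
  iaa : ∀ S, ∀ a ∈ A S, IsIAA Sp S a
  subst : ∀ n ∈ π, T.IsRoot n → ∀ σ : Subst L,
    A ((T.seq n).subst σ) = (A (T.seq n)).map (fun a => a.subst σ)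

open Classical in
/-- `S(Nʲ)[δ]` is `<_π`-derivable from `S(Nⁱ)[θ]` along `p`, where `p` leads from `Nⁱ` to `Nʲ`.
Here `Aᵢ - Aⱼ` and `Aⱼ - Aᵢ` are the multisets that remain after the pairwise deletion of the
common IAAs of `Aᵢ`, `Aⱼ`. -/
def Derivable (T : TreeSet Sp V) (lt : Atom L → Atom L → Prop)
    (A : Sequent L → Multiset (Atom L)) (p : List V) (Ni Nj : V) (θ δ : Subst L) : Prop :=
  let Ai := A ((T.seq Ni).subst θ)
  let Aj := A ((T.seq Nj).subst δ)
  let Ai' := Ai - Aj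
  let Aj' := Aj - Ai
  MultisetExt lt Aj Ai ∧
  (∀ l ∈ Aj - Aj', ∃ l' ∈ Ai - Ai', l = l' ∧ T.DerivesFrom p θ δ l' l ∧
    ∀ l₂ ∈ Aj, T.DerivesFrom p θ δ l' l₂ → l₂ = l) ∧
  (∀ l ∈ Aj', ∃ l' ∈ Ai', lt l l' ∧ T.DerivesFrom p θ δ l' l)

/-- The SCC `π` discharges its induction hypotheses: for a suitable stable ordering and a suitable
measure, for every rb-path `[R, …, H, B]` in `π` the sequent `S(H)` is `<_π`-derivable from the
cumulative instance of `S(R)`. -/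
def DischargesIHs (T : TreeSet Sp V) (π : Set V) : Prop :=
  ∃ (lt : Atom L → Atom L → Prop) (A : Sequent L → Multiset (Atom L)),
    T.IsStableOrdering π lt ∧ T.IsMeasure π A ∧
    ∀ (p : List V) (R H B : V), T.IsRbPath p R H B → (∀ n ∈ p, n ∈ π) → B ∈ π →
      T.Derivable lt A p R H (T.cumulative p) (Subst.id L)

end TreeSet

end CLKID

/-! The proof is an infinite descent on counterexamples. A valuation refuting the conclusion of a
rule other than (Subst) yields one refuting some premise (`RuleInst.exists_falsified_premise`). From
a refuted root one climbs the finite tree; axioms cannot be refuted, so the climb ends at a bud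
under (Subst), whose companion is again a refuted root (`TreeSet.exists_descent`).

Each true inductive atom has an ordinal rank, the stage at which it enters the least fixed point. An
IAA `a` of the starting root evaluates initially to the same ground atom as `a[θ^c]` finally: (Gen)
equations hold under refuting valuations, and eigenvariables are new. A trace from `a` therefore
either ends in exactly `a[θ^c]` or has lowered the rank at a (Case) step. Derivability puts each `l
∈ C'` below an `l' ∈ E'` from which it derives; irreflexivity of `<_a` excludes `l = l'`, so the
rank dropped. Hence the multiset of ranks of the measure decreases in the Dershowitz–Manna order
from root to companion (`TreeSet.Descent.measureRank_lt`). Well-foundedness comes from the ordinals;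
`<_a` itself need not be well-founded.

So the descent cannot stay in one SCC forever, and leaving an SCC shrinks the finite set of
reachable nodes (`TreeSet.not_falsified_of_isRoot`). -/

namespace CLKID

open FirstOrder FirstOrder.Language

/-! ### Substitutions and free variables. -/

section Substitution

variable {L : FirstOrder.Language.{u, v}}

theorem term_subst_subst (t : L.Term ℕ) (σ τ : Subst L) :
    (t.subst σ).subst τ = t.subst (σ.comp τ) := by
  induction t with
  | var => rfl
  | func f ts ih => simp [Term.subst, ih]

theorem term_subst_id (t : L.Term ℕ) : t.subst (Subst.id L) = t := by
  induction t with
  | var => rfl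
  | func f ts ih => simp [Term.subst, ih]

theorem Atom.subst_subst (a : Atom L) (σ τ : Subst L) :
    (a.subst σ).subst τ = a.subst (σ.comp τ) := by
  simp [Atom.subst, term_subst_subst]

theorem Atom.subst_id (a : Atom L) : a.subst (Subst.id L) = a := by
  simp [Atom.subst, term_subst_id]

theorem exists_mem_varFinset_of_mem_subst (t : L.Term ℕ) (σ : Subst L) {y : ℕ}
    (hy : y ∈ (t.subst σ).varFinset) : ∃ z ∈ t.varFinset, y ∈ (σ z).varFinset := by
  induction t with
  | var z => exact ⟨z, by simp, hy⟩
  | func f ts ih =>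
    simp only [Term.subst, Term.varFinset, Finset.mem_biUnion, Finset.mem_univ, true_and] at hy ⊢
    obtain ⟨i, hi⟩ := hy
    obtain ⟨z, hz, h⟩ := ih i hi
    exact ⟨z, ⟨i, hz⟩, h⟩

theorem Atom.exists_mem_vars_of_mem_subst (a : Atom L) (σ : Subst L) {y : ℕ}
    (hy : y ∈ (a.subst σ).vars) : ∃ z ∈ a.vars, y ∈ (σ z).varFinset := by
  obtain ⟨i, hi⟩ := hy
  obtain ⟨z, hz, h⟩ := exists_mem_varFinset_of_mem_subst _ _ hi
  exact ⟨z, ⟨i, hz⟩, h⟩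

theorem varFinsetLeft_relabel_inl {β : Type*} (t : L.Term ℕ) :
    (t.relabel (Sum.inl : ℕ → ℕ ⊕ β)).varFinsetLeft = t.varFinset := by
  induction t with
  | var => rfl
  | func f ts ih => simp [ih]

theorem Atom.mem_freeVarFinset_toFormula (a : Atom L) {y : ℕ} :
    y ∈ BoundedFormula.freeVarFinset a.toFormula ↔ y ∈ a.vars := by
  simp [Atom.toFormula, Relations.formula, Relations.boundedFormula, varFinsetLeft_relabel_inl,
    Atom.vars]

theorem mem_freeVarFinset_equal (s t : L.Term ℕ) {y : ℕ} :
    y ∈ BoundedFormula.freeVarFinset (Term.equal s t) ↔ y ∈ s.varFinset ∨ y ∈ t.varFinset := by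
  simp [Term.equal, Term.bdEqual, varFinsetLeft_relabel_inl]

theorem IsIAA.vars_subset_FV {Sp : Spec L} {S : Sequent L} {a : Atom L} (h : IsIAA Sp S a) :
    a.vars ⊆ S.FV :=
  fun _ hy => ⟨_, .inl h.2, a.mem_freeVarFinset_toFormula.2 hy⟩

end Substitution

/-! ### Evaluation, counterexamples, and stages of the inductive definition. -/

section Semantics

variable {L : FirstOrder.Language.{u, v}} {M : Type w} [L.Structure M]

theorem term_realize_congr (t : L.Term ℕ) {ρ ρ' : ℕ → M} (h : ∀ y ∈ t.varFinset, ρ y = ρ' y) :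
    t.realize ρ = t.realize ρ' := by
  induction t with
  | var => exact h _ (by simp)
  | func f ts ih =>
    simp only [Term.realize]
    congr 1
    funext i
    exact ih i fun y hy => h y (by simpa using ⟨i, hy⟩)

theorem term_realize_congr_left {β : Type*} (t : L.Term (ℕ ⊕ β)) {ρ ρ' : ℕ → M} {xs : β → M}
    (h : ∀ y ∈ t.varFinsetLeft, ρ y = ρ' y) :
    t.realize (Sum.elim ρ xs) = t.realize (Sum.elim ρ' xs) := by
  induction t with
  | var x =>
    cases x with
    | inl x => exact h _ (by simp)
    | inr x => rfl
  | func f ts ih =>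
    simp only [Term.realize]
    congr 1
    funext i
    exact ih i fun y hy => h y (by simpa using ⟨i, hy⟩)

theorem boundedFormula_realize_congr {n : ℕ} (F : L.BoundedFormula ℕ n) {ρ ρ' : ℕ → M}
    {xs : Fin n → M} (h : ∀ y ∈ F.freeVarFinset, ρ y = ρ' y) :
    F.Realize ρ xs ↔ F.Realize ρ' xs := by
  induction F with
  | falsum => rfl
  | equal t₁ t₂ =>
    simp only [BoundedFormula.freeVarFinset, Finset.mem_union] at h
    simp only [BoundedFormula.Realize]
    rw [term_realize_congr_left t₁ fun y hy => h y (.inl hy),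
      term_realize_congr_left t₂ fun y hy => h y (.inr hy)]
  | rel R ts =>
    simp only [BoundedFormula.freeVarFinset, Finset.mem_biUnion, Finset.mem_univ, true_and] at h
    simp only [BoundedFormula.Realize]
    rw [funext fun i => term_realize_congr_left (ts i) fun y hy => h y ⟨i, hy⟩]
  | imp F G ihF ihG =>
    simp only [BoundedFormula.freeVarFinset, Finset.mem_union] at h
    exact imp_congr (ihF fun y hy => h y (.inl hy)) (ihG fun y hy => h y (.inr hy))
  | all F ih => exact forall_congr' fun x => ih h

theorem formula_realize_congr (F : L.Formula ℕ) {ρ ρ' : ℕ → M}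
    (h : ∀ y ∈ BoundedFormula.freeVarFinset F, ρ y = ρ' y) : F.Realize ρ ↔ F.Realize ρ' :=
  boundedFormula_realize_congr F h

theorem formula_realize_subst (F : L.Formula ℕ) (σ : Subst L) (ρ : ℕ → M) :
    Formula.Realize (BoundedFormula.subst F σ) ρ ↔ F.Realize (fun y => (σ y).realize ρ) :=
  BoundedFormula.realize_subst

theorem openAt_realize (F : L.BoundedFormula ℕ 1) (t : L.Term ℕ) (ρ : ℕ → M) :
    (openAt F t).Realize ρ ↔ F.Realize ρ (fun _ => t.realize ρ) := by
  rw [openAt, Formula.Realize, BoundedFormula.realize_subst]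
  exact BoundedFormula.realize_toFormula F _

theorem Atom.eval_subst (a : Atom L) (σ : Subst L) (ρ : ℕ → M) :
    (a.subst σ).eval ρ = a.eval (fun y => (σ y).realize ρ) := by
  simp [Atom.eval, Atom.subst, Term.realize_subst]

theorem Atom.eval_congr (a : Atom L) {ρ ρ' : ℕ → M} (h : ∀ y ∈ a.vars, ρ y = ρ' y) :
    a.eval ρ = a.eval ρ' := by
  simp only [Atom.eval]
  congr 1
  funext i
  exact term_realize_congr _ fun y hy => h y ⟨i, hy⟩

theorem Atom.toFormula_realize (a : Atom L) (ρ : ℕ → M) :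
    a.toFormula.Realize ρ ↔ Structure.RelMap a.sym.2 (a.eval ρ).2 :=
  Formula.realize_rel

theorem Atom.toFormula_realize_iff_of_eval_eq {a b : Atom L} {ρ ρ' : ℕ → M}
    (h : a.eval ρ = b.eval ρ') : a.toFormula.Realize ρ ↔ b.toFormula.Realize ρ' := by
  -- Quantifying over whole ground atoms lets the dependent arity be transported by `rfl`.
  have key : ∀ g g' : GroundAtom L M, g = g' →
      (Structure.RelMap g.1.2 g.2 ↔ Structure.RelMap g'.1.2 g'.2) := by
    rintro g _ rfl
    rfl
  rw [a.toFormula_realize, b.toFormula_realize]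
  exact key _ _ h

theorem Atom.toFormula_realize_iff_mem_lfp {Sp : Spec L} (hM : Sp.IsStandardModel M) {a : Atom L}
    (ha : a.sym ∈ Sp.ind) (ρ : ℕ → M) :
    a.toFormula.Realize ρ ↔ a.eval ρ ∈ OrderHom.lfp (Sp.operator M) :=
  (a.toFormula_realize ρ).trans (hM a.sym ha _)

/-- Supplies the equations of a case distinction. Equal ground atoms have equal symbols, so the two
argument lists have the same length and are compared entrywise. -/
theorem realize_of_mem_zipWith_equal {p q : Atom L} {ρ : ℕ → M} (h : q.eval ρ = p.eval ρ) :
    ∀ F ∈ List.zipWith Term.equal (List.ofFn p.args) (List.ofFn q.args), F.Realize ρ := by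
  obtain ⟨s, as⟩ := p
  obtain ⟨s', bs⟩ := q
  simp only [Atom.eval, Sigma.mk.injEq] at h
  obtain ⟨rfl, h⟩ := h
  have h := eq_of_heq h
  intro F hF
  obtain ⟨i, hi, rfl⟩ := List.getElem_of_mem hF
  have hi' : i < s'.1 := by simpa using hi
  simpa using (congrFun h ⟨i, hi'⟩).symm

/-- The valuation `ρ` is a counterexample to the sequent `S`. -/
def Sequent.Falsified (S : Sequent L) (ρ : ℕ → M) : Prop :=
  (∀ G ∈ S.ant, G.Realize ρ) ∧ ∀ D ∈ S.suc, ¬ D.Realize ρ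

theorem Sequent.isTrue_of_forall_not_falsified {S : Sequent L}
    (h : ∀ ρ : ℕ → M, ¬ S.Falsified ρ) : S.IsTrue M := by
  intro ρ hρ
  by_contra! hc
  exact h ρ ⟨hρ, hc⟩

theorem Sequent.falsified_subst {S : Sequent L} {σ : Subst L} {ρ : ℕ → M} :
    (S.subst σ).Falsified ρ ↔ S.Falsified (fun y => (σ y).realize ρ) := by
  simp [Sequent.Falsified, Sequent.subst, formula_realize_subst]

theorem Sequent.falsified_congr {S : Sequent L} {ρ ρ' : ℕ → M} (h : ∀ y ∈ S.FV, ρ y = ρ' y) :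
    S.Falsified ρ ↔ S.Falsified ρ' :=
  and_congr
    (forall₂_congr fun F hF => formula_realize_congr F fun y hy => h y ⟨F, .inl hF, hy⟩)
    (forall₂_congr fun F hF => not_congr <|
      formula_realize_congr F fun y hy => h y ⟨F, .inr hF, hy⟩)

/-- The stage of the inductive definition at which a ground atom is derived. -/
noncomputable def rank (Sp : Spec L) (g : GroundAtom L M) : Ordinal :=
  sInf {α | g ∈ OrdinalApprox.lfpApprox (Sp.operator M) ⊥ α}

/-- The stage `α` is the union of the operator applied to the stages `β < α`. At the least stage
containing `g`, some production thus derives `g` from inductive atoms already present at a smaller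
`β`. -/
theorem exists_production_of_mem_lfp (Sp : Spec L) {g : GroundAtom L M}
    (hg : g ∈ OrderHom.lfp (Sp.operator M)) :
    ∃ c ∈ Sp.prods, ∃ ρ : ℕ → M, c.head.eval ρ = g ∧ (∀ a ∈ c.ords, a.toFormula.Realize ρ) ∧
      ∀ a ∈ c.inds, a.eval ρ ∈ OrderHom.lfp (Sp.operator M) ∧
        rank Sp (a.eval ρ) < rank Sp g := by
  obtain ⟨α, hα⟩ := OrdinalApprox.lfp_mem_range_lfpApprox (Sp.operator M)
  have hne : {α | g ∈ OrdinalApprox.lfpApprox (Sp.operator M) ⊥ α}.Nonempty := ⟨α, hα.ge hg⟩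
  have hmem := csInf_mem hne
  rw [Set.mem_ofPred_eq, OrdinalApprox.lfpApprox] at hmem
  simp only [bot_sup_eq, Set.iSup_eq_iUnion, Set.mem_iUnion] at hmem
  obtain ⟨β, hβ, c, hc, ρ, hhead, hords, hinds⟩ := hmem
  refine ⟨c, hc, ρ, hhead, hords, fun a ha => ⟨?_, lt_of_le_of_lt (csInf_le' ?_) hβ⟩⟩
  · have hle : OrdinalApprox.lfpApprox (Sp.operator M) ⊥ β ≤ OrderHom.lfp (Sp.operator M) :=
      OrdinalApprox.lfpApprox_le_of_mem_fixedPoints _ (OrderHom.map_lfp _) bot_le β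
    exact hle (hinds a ha)
  · exact hinds a ha

end Semantics

/-! ### Local soundness of the rules, with ranks. -/

section RuleSoundness

variable {L : FirstOrder.Language.{u, v}} {M : Type w} [L.Structure M] {Sp : Spec L}

/-- A counterexample to the conclusion of (Gen) satisfies the principal equation, so replacing the
variable by the term changes no value. -/
theorem RuleInst.realize_annot (r : RuleInst L) {ρ : ℕ → M} (hf : r.concl.Falsified ρ) (y : ℕ) :
    (r.annot y).realize ρ = ρ y := by
  cases r
  case gen Γ Δ z t =>
    have h := hf.1 _ (Multiset.mem_cons_self _ _)
    rw [Formula.realize_equal] at h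
    simp only [RuleInst.annot, Subst.single]
    split_ifs with hyz
    · rw [hyz]
      exact h.symm
    · rfl
  all_goals rfl

/-- Ensures that instantiating along a branch never brings in a variable foreign to that branch, so
later eigenvariables stay new for the instantiated atoms. -/
theorem RuleInst.mem_FV_of_mem_annot (r : RuleInst L) {y z : ℕ} (h : z ∈ (r.annot y).varFinset) :
    z = y ∨ z ∈ r.concl.FV := by
  cases r
  case gen Γ Δ x t =>
    simp only [RuleInst.annot, Subst.single] at h
    split_ifs at h
    · exact .inr ⟨_, .inl (Multiset.mem_cons_self _ _), (mem_freeVarFinset_equal _ _).2 (.inr h)⟩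
    · exact .inl (by simpa using h)
  all_goals exact .inl (by simpa [RuleInst.annot, Subst.id] using h)

theorem snoc_default_eq_const (m : M) : (Fin.snoc default m : Fin 1 → M) = fun _ => m := by
  funext i
  simp [Fin.snoc]

theorem formula_realize_all (F : L.BoundedFormula ℕ 1) (ρ : ℕ → M) :
    Formula.Realize F.all ρ ↔ ∀ m, F.Realize ρ (fun _ => m) := by
  simp [Formula.Realize, snoc_default_eq_const]

theorem formula_realize_ex (F : L.BoundedFormula ℕ 1) (ρ : ℕ → M) :
    Formula.Realize F.ex ρ ↔ ∃ m, F.Realize ρ (fun _ => m) := by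
  simp [Formula.Realize, snoc_default_eq_const]

theorem boundedFormula_realize_update {n : ℕ} {F : L.BoundedFormula ℕ n} {y : ℕ}
    (hy : y ∉ F.freeVarFinset) (ρ : ℕ → M) (m : M) (xs : Fin n → M) :
    F.Realize (Function.update ρ y m) xs ↔ F.Realize ρ xs :=
  boundedFormula_realize_congr F fun _ hz =>
    Function.update_of_ne (by rintro rfl; exact hy hz) _ _

theorem Sequent.falsified_update {S : Sequent L} {ρ : ℕ → M} (h : S.Falsified ρ) {y : ℕ}
    (hy : y ∉ S.FV) (m : M) : S.Falsified (Function.update ρ y m) := by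
  refine (Sequent.falsified_congr fun z hz => ?_).2 h
  exact Function.update_of_ne (by rintro rfl; exact hy hz) _ _

/-- The unfolding of a true inductive atom: some case distinction is falsified, and its case
descendants have smaller rank. -/
theorem exists_falsified_caseDistinction (hM : Sp.IsStandardModel M)
    {Γ Δ : Multiset (L.Formula ℕ)} {p : Atom L} {r : Production L → ℕ → ℕ}
    (hok : (RuleInst.case Γ Δ p r).Ok Sp) {ρ : ℕ → M}
    (hf : (RuleInst.case Γ Δ p r).concl.Falsified ρ) :
    ∃ c ∈ Sp.prodsFor p, ∃ ρ' : ℕ → M, (caseDistinction Γ Δ p c (r c)).Falsified ρ' ∧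
      (∀ y ∉ (RuleInst.case Γ Δ p r).eigen Sp, ρ' y = ρ y) ∧
      ∀ d ∈ c.inds, rank Sp ((d.subst (ren (r c))).eval ρ') < rank Sp (p.eval ρ) := by
  classical
  obtain ⟨⟨hp, hinj⟩, hnew⟩ := hok
  have hpmem := (Atom.toFormula_realize_iff_mem_lfp hM hp ρ).1
    (hf.1 _ (Multiset.mem_cons_self _ _))
  obtain ⟨c, hc, ρ₀, hhead, hords, hinds⟩ := exists_production_of_mem_lfp Sp hpmem
  have hcp : c ∈ Sp.prodsFor p := by
    rw [Spec.prodsFor, List.mem_filter]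
    exact ⟨hc, decide_eq_true (congrArg Sigma.fst hhead)⟩
  -- The renamed variables of the production take the values of the derivation witness `ρ₀`;
  -- injectivity of the renaming makes the choice of preimage harmless.
  let ρ' : ℕ → M := fun y => if h : ∃ z ∈ c.vars, r c z = y then ρ₀ h.choose else ρ y
  have hren : ∀ z ∈ c.vars, ρ' (r c z) = ρ₀ z := by
    intro z hz
    have h : ∃ z' ∈ c.vars, r c z' = r c z := ⟨z, hz, rfl⟩
    simp only [ρ', dif_pos h]
    exact congrArg ρ₀ (hinj c hcp h.choose_spec.1 hz h.choose_spec.2)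
  have hold : ∀ y ∉ (RuleInst.case Γ Δ p r).eigen Sp, ρ' y = ρ y := by
    intro y hy
    refine dif_neg ?_
    rintro ⟨z, hz, rfl⟩
    exact hy ⟨c, hcp, z, hz, rfl⟩
  have heval : ∀ a : Atom L, a.vars ⊆ c.vars → (a.subst (ren (r c))).eval ρ' = a.eval ρ₀ := by
    intro a ha
    rw [Atom.eval_subst]
    exact a.eval_congr fun z hz => hren z (ha hz)
  have hordvars : ∀ a ∈ c.ords, a.vars ⊆ c.vars := fun a ha y hy => .inl ⟨a, ha, hy⟩
  have hindvars : ∀ a ∈ c.inds, a.vars ⊆ c.vars := fun a ha y hy => .inr (.inl ⟨a, ha, hy⟩)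
  have hheadvars : c.head.vars ⊆ c.vars := fun y hy => .inr (.inr hy)
  have hf' : (RuleInst.case Γ Δ p r).concl.Falsified ρ' :=
    (Sequent.falsified_congr fun y hy => hold y fun he => hnew y he hy).2 hf
  have hpeval : p.eval ρ' = p.eval ρ := p.eval_congr fun y hy => hold y fun he =>
    hnew y he ⟨p.toFormula, .inl (Multiset.mem_cons_self _ _), p.mem_freeVarFinset_toFormula.2 hy⟩
  refine ⟨c, hcp, ρ', ⟨?_, hf'.2⟩, hold, fun d hd => ?_⟩
  · intro G hG
    simp only [caseDistinction, Multiset.mem_add, Multiset.mem_coe, List.mem_map] at hG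
    rcases hG with ((hG | hG) | ⟨a, ha, rfl⟩) | ⟨a, ha, rfl⟩
    · exact hf'.1 G (Multiset.mem_cons_of_mem hG)
    · exact realize_of_mem_zipWith_equal
        ((heval _ hheadvars).trans (hhead.trans hpeval.symm)) G hG
    · exact (Atom.toFormula_realize_iff_of_eval_eq (heval a (hordvars a ha))).2 (hords a ha)
    · refine (Atom.toFormula_realize_iff_of_eval_eq (heval a (hindvars a ha))).2 ?_
      exact (Atom.toFormula_realize_iff_mem_lfp hM (Sp.inds_inductive c hc a ha) ρ₀).2
        (hinds a ha).1
  · rw [heval d (hindvars d hd)]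
    exact (hinds d hd).2

/-- Local soundness: a counterexample to the conclusion of a rule yields one to some premise.
Along the steps of traces to this premise, atoms are either just instantiated or decrease in
rank. -/
theorem RuleInst.exists_falsified_premise (hM : Sp.IsStandardModel M) (r : RuleInst L)
    (hns : ¬ r.IsSubst) (hok : r.Ok Sp) {ρ : ℕ → M} (hf : r.concl.Falsified ρ) :
    ∃ (k : ℕ) (S : Sequent L) (ρ' : ℕ → M), (r.prems Sp)[k]? = some S ∧ S.Falsified ρ' ∧
      (∀ y ∉ r.eigen Sp, ρ' y = ρ y) ∧
      ∀ a b, r.TraceStep Sp k a b →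
        b = a.subst r.annot ∨ rank Sp (b.eval ρ') < rank Sp (a.eval ρ) := by
  cases r
  case case Γ Δ p r =>
    obtain ⟨c, hc, ρ', hf', hold, hrank⟩ := exists_falsified_caseDistinction hM hok hf
    obtain ⟨k, hk⟩ := List.mem_iff_getElem?.1 hc
    refine ⟨k, _, ρ', by simp only [RuleInst.prems, List.getElem?_map, hk]; rfl, hf', hold, ?_⟩
    rintro a b (⟨-, rfl⟩ | ⟨rfl, c', hc', d, hd, rfl⟩)
    · exact .inl b.subst_id.symm
    · obtain rfl : c = c' := Option.some.inj (hk.symm.trans hc')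
      exact .inr (hrank d hd)
  case unfold Γ Δ c σ =>
    -- Otherwise the head would lie in the operator applied to its least fixed point, hence in the
    -- fixed point itself.
    have hstep : ∃ a ∈ c.ords ++ c.inds, ¬ (a.subst σ).toFormula.Realize ρ := by
      by_contra! hc
      refine hf.2 _ (Multiset.mem_cons_self _ _) ?_
      refine (Atom.toFormula_realize_iff_mem_lfp hM (a := c.head.subst σ)
        (Sp.head_inductive c hok.1) ρ).2 ?_
      rw [← OrderHom.map_lfp]
      refine ⟨c, hok.1, fun y => (σ y).realize ρ, (c.head.eval_subst σ ρ).symm,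
        fun a ha => ?_, fun a ha => ?_⟩
      · exact (Atom.toFormula_realize_iff_of_eval_eq (a.eval_subst σ ρ)).1
          (hc a (List.mem_append_left _ ha))
      · rw [← a.eval_subst σ ρ]
        exact (Atom.toFormula_realize_iff_mem_lfp hM (a := a.subst σ)
          (Sp.inds_inductive c hok.1 a ha) ρ).1 (hc a (List.mem_append_right _ ha))
    obtain ⟨a, ha, hna⟩ := hstep
    obtain ⟨k, hk⟩ := List.mem_iff_getElem?.1 ha
    refine ⟨k, ⟨Γ, (a.subst σ).toFormula ::ₘ Δ⟩, ρ, ?_, ⟨hf.1, ?_⟩, fun _ _ => rfl,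
      fun a b h => .inl (h.trans a.subst_id.symm)⟩
    · simp only [RuleInst.prems, ← List.map_append, List.getElem?_map, hk]
      rfl
    · intro D hD
      rcases Multiset.mem_cons.1 hD with rfl | hD
      · exact hna
      · exact hf.2 D (Multiset.mem_cons_of_mem hD)
  case gen Γ Δ y t =>
    refine ⟨0, _, ρ, rfl, ?_, fun _ _ => rfl, fun a b h => .inl h⟩
    have hρ : (fun z => (Subst.single y t z).realize ρ) = ρ :=
      funext ((RuleInst.gen Γ Δ y t).realize_annot hf)
    rw [Sequent.falsified_subst, hρ]
    exact ⟨fun G hG => hf.1 G (Multiset.mem_cons_of_mem hG), hf.2⟩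
  case subst => exact (hns trivial).elim
  case allR Γ Δ F y =>
    have hy := hok.2 y rfl
    have h := hf.2 _ (Multiset.mem_cons_self _ _)
    rw [formula_realize_all] at h
    push Not at h
    obtain ⟨m, hm⟩ := h
    have hf' := Sequent.falsified_update hf hy m
    refine ⟨0, _, Function.update ρ y m, rfl, ⟨hf'.1, fun D hD => ?_⟩,
      fun z hz => Function.update_of_ne hz _ _, fun a b h => .inl (h.trans a.subst_id.symm)⟩
    rcases Multiset.mem_cons.1 hD with rfl | hD
    · have hyF : y ∉ F.freeVarFinset := fun h => hy ⟨F.all, .inr (Multiset.mem_cons_self _ _), h⟩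
      rwa [openAt_realize, Term.realize_var, Function.update_self,
        boundedFormula_realize_update hyF]
    · exact hf'.2 D (Multiset.mem_cons_of_mem hD)
  case exL Γ Δ F y =>
    have hy := hok.2 y rfl
    have h := hf.1 _ (Multiset.mem_cons_self _ _)
    rw [formula_realize_ex] at h
    obtain ⟨m, hm⟩ := h
    have hf' := Sequent.falsified_update hf hy m
    refine ⟨0, _, Function.update ρ y m, rfl, ⟨fun D hD => ?_, hf'.2⟩,
      fun z hz => Function.update_of_ne hz _ _, fun a b h => .inl (h.trans a.subst_id.symm)⟩
    rcases Multiset.mem_cons.1 hD with rfl | hD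
    · have hyF : y ∉ F.freeVarFinset := fun h => hy ⟨F.ex, .inl (Multiset.mem_cons_self _ _), by
        simpa [BoundedFormula.ex, BoundedFormula.not] using h⟩
      rwa [openAt_realize, Term.realize_var, Function.update_self,
        boundedFormula_realize_update hyF]
    · exact hf'.1 D (Multiset.mem_cons_of_mem hD)
  case ax Γ Δ F => simp [RuleInst.concl, Sequent.Falsified] at hf; grind
  case eqR => simp [RuleInst.concl, Sequent.Falsified] at hf
  case botL => simp [RuleInst.concl, Sequent.Falsified] at hf
  case cut Γ Δ F =>
    by_cases hF : F.Realize ρ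
    · refine ⟨1, _, ρ, rfl, ?_, fun _ _ => rfl, fun a b h => .inl (h.trans a.subst_id.symm)⟩
      simp_all [RuleInst.concl, Sequent.Falsified]
    · refine ⟨0, _, ρ, rfl, ?_, fun _ _ => rfl, fun a b h => .inl (h.trans a.subst_id.symm)⟩
      simp_all [RuleInst.concl, Sequent.Falsified]
  case andR Γ Δ F G =>
    by_cases hF : F.Realize ρ
    · refine ⟨1, _, ρ, rfl, ?_, fun _ _ => rfl, fun a b h => .inl (h.trans a.subst_id.symm)⟩
      simp_all [RuleInst.concl, Sequent.Falsified]
    · refine ⟨0, _, ρ, rfl, ?_, fun _ _ => rfl, fun a b h => .inl (h.trans a.subst_id.symm)⟩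
      simp_all [RuleInst.concl, Sequent.Falsified]
  case orL Γ Δ F G =>
    by_cases hF : F.Realize ρ
    · refine ⟨0, _, ρ, rfl, ?_, fun _ _ => rfl, fun a b h => .inl (h.trans a.subst_id.symm)⟩
      simp_all [RuleInst.concl, Sequent.Falsified]
    · refine ⟨1, _, ρ, rfl, ?_, fun _ _ => rfl, fun a b h => .inl (h.trans a.subst_id.symm)⟩
      simp_all [RuleInst.concl, Sequent.Falsified]
  case impL Γ Δ F G =>
    by_cases hF : F.Realize ρ
    · refine ⟨1, _, ρ, rfl, ?_, fun _ _ => rfl, fun a b h => .inl (h.trans a.subst_id.symm)⟩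
      simp_all [RuleInst.concl, Sequent.Falsified]
    · refine ⟨0, _, ρ, rfl, ?_, fun _ _ => rfl, fun a b h => .inl (h.trans a.subst_id.symm)⟩
      simp_all [RuleInst.concl, Sequent.Falsified]
  all_goals
    refine ⟨0, _, ρ, rfl, ?_, fun _ _ => rfl, fun a b h => .inl (h.trans a.subst_id.symm)⟩
    simp_all [RuleInst.concl, Sequent.Falsified, openAt_realize, formula_realize_all,
      formula_realize_ex]

end RuleSoundness

/-! ### Descent from a refuted node to a refuted companion. -/

namespace TreeSet

variable {L : FirstOrder.Language.{u, v}} {Sp : Spec L} {V : Type x} {M : Type w} [L.Structure M]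

/-- The variables that are free in some sequent between the root of the tree and the node `n`. -/
def branchVars (T : TreeSet Sp V) (n : V) : Set ℕ :=
  {y | ∃ m, Relation.ReflTransGen T.Child m n ∧ y ∈ (T.seq m).FV}

theorem FV_subset_branchVars (T : TreeSet Sp V) (n : V) : (T.seq n).FV ⊆ T.branchVars n :=
  fun _ hy => ⟨n, .refl, hy⟩

theorem Child.branchVars_subset {T : TreeSet Sp V} {m n : V} (h : T.Child m n) :
    T.branchVars m ⊆ T.branchVars n :=
  fun _ ⟨k, hk, hy⟩ => ⟨k, hk.tail h, hy⟩

theorem wellFounded_child [Finite V] (T : TreeSet Sp V) :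
    WellFounded (fun m n => T.Child n m) := by
  let r : V → V → Prop := fun m n => Relation.TransGen T.Child n m
  have : IsTrans V r := ⟨fun _ _ _ h₁ h₂ => h₂.trans h₁⟩
  have : Std.Irrefl r := ⟨T.acyclic⟩
  exact Subrelation.wf (fun h => Relation.TransGen.single h)
    (Finite.wellFounded_of_trans_of_irrefl r)

theorem TraceAlong.isIAA {T : TreeSet Sp V} {n : V} {p : List V} {a b : Atom L}
    (h : T.TraceAlong (n :: p) a b) : IsIAA Sp (T.seq n) a := by
  cases h <;> assumption

/-- Refuting the sequent of `n` by `ρ` leads along `p = [n, …, H]` to a bud `B` with companion `R`;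
the last node `H` is the conclusion of a `(Subst)` step with the substitution `θ`, and its sequent
is refuted by `ρ'`. -/
structure Descent (T : TreeSet Sp V) (n : V) (ρ : ℕ → M) (p : List V) (H B R : V) (θ : Subst L)
    (ρ' : ℕ → M) : Prop where
  head : p.head? = some n
  last : p.getLast? = some H
  chain : List.IsChain T.Child (p ++ [B])
  between : ∀ m ∈ p, Relation.ReflTransGen T.Child n m ∧ Relation.ReflTransGen T.Child m B
  child : T.Child H B
  bud : T.just B = Just.bud R
  seq_last : T.seq H = (T.seq R).subst θ
  falsified : (T.seq H).Falsified ρ'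
  eval : ∀ a : Atom L, a.vars ⊆ T.branchVars n → (a.subst (T.cumulative p)).eval ρ' = a.eval ρ
  trace : ∀ a b, T.TraceAlong p a b →
    b = a.subst (T.cumulative p) ∨ rank Sp (b.eval ρ') < rank Sp (a.eval ρ)

theorem annot_eq {T : TreeSet Sp V} {n : V} {r : RuleInst L} (h : T.just n = Just.rule r) :
    T.annot n = r.annot := by
  rw [annot, h]

/-- The premise is terminal and refuted. Were it not a bud, it would conclude a rule without
premises, and local soundness would demand a refuted premise. -/
theorem exists_bud_of_isSubst {T : TreeSet Sp V} (hM : Sp.IsStandardModel M)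
    (hnorm : T.IsNormalised) {n : V} {ρ : ℕ → M} (hf : (T.seq n).Falsified ρ) {r : RuleInst L}
    (hr : T.just n = Just.rule r) (hs : r.IsSubst) :
    ∃ B R θ, T.Child n B ∧ T.just B = Just.bud R ∧ T.seq n = (T.seq R).subst θ := by
  obtain ⟨hok, hconcl, hprems⟩ := T.rule_ok n r hr
  have hterm := hnorm.subst_terminal n ⟨r, hr, hs⟩
  cases r
  case subst Γ Δ θ =>
    obtain ⟨B, hB⟩ : ∃ B, T.kids n = [B] := by
      rw [← List.length_eq_one_iff, ← List.length_map (as := T.kids n) (f := T.seq), ← hprems]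
      rfl
    have hchild : T.Child n B := by simp [Child, hB]
    have hseq : T.seq B = ⟨Γ, Δ⟩ := by
      simpa [hB, RuleInst.prems] using hprems.symm
    have hn : T.seq n = (T.seq B).subst θ := by rw [hseq, ← hconcl, RuleInst.concl]
    cases hj : T.just B with
    | bud R => exact ⟨B, R, θ, hchild, hj, by rw [(T.bud_ok B R hj).2, hn]⟩
    | rule r' =>
      obtain ⟨hok', hconcl', hprems'⟩ := T.rule_ok B r' hj
      rw [hterm B hchild, List.map_nil] at hprems'
      rw [hn, Sequent.falsified_subst, ← hconcl'] at hf
      have hns : ¬ r'.IsSubst := by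
        intro h
        cases r' <;> simp_all [RuleInst.IsSubst, RuleInst.prems]
      obtain ⟨k, S, ρ', hk, -⟩ := r'.exists_falsified_premise hM hns hok' hf
      simp [hprems'] at hk
  all_goals exact hs.elim

/-- A descent from a premise extends to a descent from the conclusion of a rule. -/
theorem Descent.cons {T : TreeSet Sp V} (hnew : T.EigenvariablesNew) {n m : V} {k : ℕ}
    {r : RuleInst L} (hr : T.just n = Just.rule r) (hk : (T.kids n)[k]? = some m)
    {ρ ρ₁ : ℕ → M} (hf : (T.seq n).Falsified ρ) (hold : ∀ y ∉ r.eigen Sp, ρ₁ y = ρ y)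
    (hstep : ∀ a b, r.TraceStep Sp k a b →
      b = a.subst r.annot ∨ rank Sp (b.eval ρ₁) < rank Sp (a.eval ρ))
    {p : List V} {H B R : V} {θ : Subst L} {ρ' : ℕ → M} (d : T.Descent m ρ₁ p H B R θ ρ') :
    T.Descent n ρ (n :: p) H B R θ ρ' := by
  have hconcl := (T.rule_ok n r hr).2.1
  have hchild : T.Child n m := List.mem_of_getElem? hk
  obtain ⟨q, rfl⟩ : ∃ q, p = m :: q := by
    cases p with
    | nil => simpa using d.head
    | cons m' q => exact ⟨q, by rw [Option.some.inj d.head]⟩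
  -- The eigenvariable convention covers all sequents down to the root, so changing eigenvariables
  -- leaves every variable of the branch alone.
  have hagree : ∀ y ∈ T.branchVars n, ρ₁ y = ρ y := by
    rintro y ⟨l, hl, hy⟩
    exact hold y fun he => hnew n r hr l hl y he hy
  have hcum : T.cumulative (n :: m :: q) = r.annot.comp (T.cumulative (m :: q)) := by
    rw [cumulative, annot_eq hr]
  have hvars : ∀ a : Atom L, a.vars ⊆ T.branchVars n →
      (a.subst r.annot).vars ⊆ T.branchVars n := by
    intro a ha y hy
    obtain ⟨z, hz, hyz⟩ := a.exists_mem_vars_of_mem_subst _ hy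
    rcases r.mem_FV_of_mem_annot hyz with rfl | h
    · exact ha hz
    · exact T.FV_subset_branchVars n (hconcl ▸ h)
  have heval : ∀ a : Atom L, a.vars ⊆ T.branchVars n →
      (a.subst r.annot).eval ρ₁ = a.eval ρ := by
    intro a ha
    rw [(a.subst r.annot).eval_congr fun y hy => hagree y (hvars a ha hy), Atom.eval_subst]
    exact a.eval_congr fun y _ => r.realize_annot (hconcl ▸ hf) y
  refine ⟨rfl, by rw [List.getLast?_cons_cons]; exact d.last, d.chain.cons_cons hchild, ?_,
    d.child, d.bud, d.seq_last, d.falsified, ?_, ?_⟩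
  · intro l hl
    rcases List.mem_cons.1 hl with rfl | hl
    · exact ⟨.refl, .head hchild (d.between m List.mem_cons_self).2⟩
    · exact ⟨.head hchild (d.between l hl).1, (d.between l hl).2⟩
  · intro a ha
    rw [hcum, ← Atom.subst_subst, d.eval _ ((hvars a ha).trans hchild.branchVars_subset),
      heval a ha]
  · intro a c htr
    have ha := htr.isIAA.vars_subset_FV.trans (T.FV_subset_branchVars n)
    cases htr with
    | cons _ _ _ r' k' _ b _ _ hr' hk' hs htr =>
      obtain rfl : r = r' := by simpa [hr] using hr'
      -- Distinctness of the children identifies the premise number used by the trace with the one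
      -- chosen by local soundness.
      obtain rfl : k = k' :=
        (List.getElem?_inj (List.getElem?_eq_some_iff.1 hk).1 (T.kids_nodup n)).1
          (hk.trans hk'.symm)
      have hb := htr.isIAA.vars_subset_FV.trans (T.FV_subset_branchVars m)
      rw [hcum, ← Atom.subst_subst]
      -- Pure instantiation preserves the value, so a drop at this step survives whatever the rest
      -- of the trace does.
      rcases hstep a b hs with rfl | hlt
      · rw [← heval a ha]
        exact d.trace _ _ htr
      · refine .inr ?_
        rcases d.trace _ _ htr with rfl | hlt'
        · rwa [d.eval b hb]
        · exact hlt'.trans hlt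

theorem exists_descent [Finite V] {T : TreeSet Sp V} (hM : Sp.IsStandardModel M)
    (hnew : T.EigenvariablesNew) (hnorm : T.IsNormalised) (n : V) :
    ¬ T.IsBud n → ∀ ρ : ℕ → M, (T.seq n).Falsified ρ →
      ∃ p H B R θ ρ', T.Descent n ρ p H B R θ ρ' := by
  induction n using T.wellFounded_child.induction with | _ n ih
  intro hnb ρ hf
  cases hj : T.just n with
  | bud R => exact (hnb ⟨R, hj⟩).elim
  | rule r =>
    by_cases hs : r.IsSubst
    · obtain ⟨B, R, θ, hB, hbud, hseq⟩ := exists_bud_of_isSubst hM hnorm hf hj hs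
      refine ⟨[n], n, B, R, θ, ρ, rfl, rfl, by simpa using hB, ?_, hB, hbud, hseq, hf,
        fun a _ => by rw [cumulative, Atom.subst_id], fun a b h => ?_⟩
      · intro m hm
        obtain rfl := List.mem_singleton.1 hm
        exact ⟨.refl, .single hB⟩
      · cases h
        exact .inl (Atom.subst_id _).symm
    · obtain ⟨hok, hconcl, hprems⟩ := T.rule_ok n r hj
      obtain ⟨k, S, ρ₁, hk, hf₁, hold, hstep⟩ :=
        r.exists_falsified_premise hM hs hok (hconcl ▸ hf)
      rw [hprems, List.getElem?_map] at hk
      obtain ⟨m, hm, rfl⟩ := Option.map_eq_some_iff.1 hk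
      have hchild : T.Child n m := List.mem_of_getElem? hm
      -- Parents are unique and buds are premises of (Subst) only, whereas `n` concludes another
      -- rule.
      have hmb : ¬ T.IsBud m := by
        intro hb
        obtain ⟨h, hhm, r', hr', hs'⟩ := hnorm.bud_subst m hb
        obtain rfl := T.parent_unique h n m hhm hchild
        obtain rfl : r = r' := by simpa [hj] using hr'
        exact hs hs'
      obtain ⟨p, H, B, R, θ, ρ', d⟩ := ih m hchild hmb ρ₁ hf₁
      exact ⟨n :: p, H, B, R, θ, ρ', d.cons hnew hj hm hf hold hstep⟩

end TreeSet

theorem formula_subst_id {L : FirstOrder.Language.{u, v}} (F : L.Formula ℕ) :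
    BoundedFormula.subst F (Subst.id L) = F := by
  have hvar : ∀ n, (Sum.elim (Term.relabel Sum.inl ∘ Subst.id L) (Term.var ∘ Sum.inr) :
      ℕ ⊕ Fin n → L.Term (ℕ ⊕ Fin n)) = Term.var := by
    intro n
    funext y
    cases y <;> rfl
  have hterm : ∀ n (t : L.Term (ℕ ⊕ Fin n)), t.subst Term.var = t := by
    intro n t
    induction t with
    | var => rfl
    | func f ts ih => simp [Term.subst, ih]
  simp only [BoundedFormula.subst, hvar, hterm]
  exact BoundedFormula.mapTermRel_id_id_id F

theorem Sequent.subst_id {L : FirstOrder.Language.{u, v}} (S : Sequent L) :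
    S.subst (Subst.id L) = S := by
  simp [Sequent.subst, formula_subst_id]

/-- Cancelling the common part gives `Y = Z`, so every element of a finite nonempty collection would
have a larger one in it. Minimality for the reversed relation provides a maximal element, a
contradiction. -/
theorem not_multisetExt_self {α : Type*} {lt : α → α → Prop} {s : Set α}
    (hirr : ∀ a ∈ s, ¬ lt a a)
    (htrans : ∀ a ∈ s, ∀ b ∈ s, ∀ c ∈ s, lt a b → lt b c → lt a c) {A : Multiset α}
    (hA : ∀ a ∈ A, a ∈ s) : ¬ MultisetExt lt A A := by
  rintro ⟨X, Y, Z, hZ, rfl, hYZ, hlt⟩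
  obtain rfl : Y = Z := add_left_cancel hYZ
  have hYs : ∀ y ∈ Y, y ∈ s := fun y hy => hA y (Multiset.mem_add.2 (.inr hy))
  let r : {y // y ∈ Y} → {y // y ∈ Y} → Prop := fun a b => lt b a
  have : IsTrans _ r :=
    ⟨fun a b c h₁ h₂ => htrans c (hYs _ c.2) b (hYs _ b.2) a (hYs _ a.2) h₂ h₁⟩
  have : Std.Irrefl r := ⟨fun a => hirr a (hYs _ a.2)⟩
  have : Finite {y // y ∈ Y} := Multiset.finite_toSet Y
  obtain ⟨y, hy⟩ := Multiset.exists_mem_of_ne_zero hZ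
  obtain ⟨m, -, hm⟩ := (Finite.wellFounded_of_trans_of_irrefl r).has_min Set.univ ⟨⟨y, hy⟩, trivial⟩
  obtain ⟨z, hz, hmz⟩ := hlt m m.2
  exact hm ⟨z, hz⟩ trivial hmz

/-! ### Decrease of the measure and induction over the components. -/

namespace TreeSet

variable {L : FirstOrder.Language.{u, v}} {Sp : Spec L} {V : Type x} {M : Type w} [L.Structure M]

/-- The multiset of the ranks of the measure of a sequent under a valuation. -/
noncomputable def measureRank (Sp : Spec L) (A : Sequent L → Multiset (Atom L)) (S : Sequent L)
    (ρ : ℕ → M) : Multiset Ordinal :=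
  (A S).map fun a => rank Sp (a.eval ρ)

/-- Along an rb-path with derivable end, the ranks of the measure decrease. -/
theorem Descent.measureRank_lt {T : TreeSet Sp V} {π : Set V} {lt : Atom L → Atom L → Prop}
    {A : Sequent L → Multiset (Atom L)} (hlt : T.IsStableOrdering π lt) (hA : T.IsMeasure π A)
    {Q H B R : V} {p : List V} {ρ ρ' : ℕ → M} {θ : Subst L} (d : T.Descent Q ρ p H B R θ ρ')
    (hQ : T.IsRoot Q) (hQπ : Q ∈ π) (hR : T.IsRoot R) (hRπ : R ∈ π)
    (hder : T.Derivable lt A p Q H (T.cumulative p) (Subst.id L)) :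
    Multiset.IsDershowitzMannaLT
      (measureRank Sp A (T.seq R) fun y => (θ y).realize ρ')
      (measureRank Sp A (T.seq Q) ρ) := by
  classical
  obtain ⟨hext, -, hdec⟩ := hder
  rw [Sequent.subst_id] at hext hdec
  set E := A ((T.seq Q).subst (T.cumulative p)) with hE
  set C := A (T.seq H) with hC
  have hEmap := hA.subst Q hQπ hQ (T.cumulative p)
  have hCmap := hA.subst R hRπ hR θ
  rw [← d.seq_last] at hCmap
  have hEinst : ∀ l ∈ E, l ∈ T.iaaInstances π := by
    intro l hl
    rw [hE, hEmap] at hl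
    obtain ⟨a, ha, rfl⟩ := Multiset.mem_map.1 hl
    exact ⟨Q, hQπ, a, hA.iaa _ a ha, _, rfl⟩
  -- This equality and the next express the measures of both roots through the single valuation
  -- `ρ'`, where `E` and `C` can be compared.
  have hErank : E.map (fun a => rank Sp (a.eval ρ')) = measureRank Sp A (T.seq Q) ρ := by
    rw [hE, hEmap, Multiset.map_map, measureRank]
    refine Multiset.map_congr rfl fun a ha => ?_
    rw [Function.comp_apply,
      d.eval a ((hA.iaa _ a ha).vars_subset_FV.trans (T.FV_subset_branchVars Q))]
  have hCrank : C.map (fun a => rank Sp (a.eval ρ')) =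
      measureRank Sp A (T.seq R) fun y => (θ y).realize ρ' := by
    rw [hC, hCmap, Multiset.map_map, measureRank]
    exact Multiset.map_congr rfl fun a _ => congrArg _ (a.eval_subst θ ρ')
  -- If nothing of `E` remained, condition (iii) would leave nothing of `C` either; then `C = E`,
  -- against `C <_π E`.
  have hsub : E - C ≠ 0 := by
    intro h0
    have hCE : C - E = 0 := by
      refine Multiset.eq_zero_of_forall_notMem fun l hl => ?_
      obtain ⟨l', hl', -⟩ := hdec l hl
      simp [h0] at hl'
    have hEC : C = E := le_antisymm (tsub_eq_zero_iff_le.1 hCE) (tsub_eq_zero_iff_le.1 h0)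
    rw [hEC] at hext
    exact not_multisetExt_self hlt.irrefl hlt.trans hEinst hext
  rw [← hErank, ← hCrank]
  set f : Atom L → Ordinal := fun a => rank Sp (a.eval ρ')
  -- Common atoms have the same rank under `ρ'`, so their ranks form the unchanged part.
  refine ⟨(C ∩ E).map f, (C - E).map f, (E - C).map f, by simpa using hsub, ?_, ?_, ?_⟩
  · rw [← Multiset.map_add, add_comm, Multiset.sub_add_inter]
  · rw [← Multiset.map_add, add_comm, Multiset.inter_comm, Multiset.sub_add_inter]
  · intro o ho
    obtain ⟨l, hl, rfl⟩ := Multiset.mem_map.1 ho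
    obtain ⟨l', hl', hll', a, b, htr, rfl, rfl⟩ := hdec l hl
    refine ⟨_, Multiset.mem_map_of_mem _ hl', ?_⟩
    simp only [f]
    obtain ⟨q, rfl⟩ : ∃ q, p = Q :: q := by
      cases p with
      | nil => simpa using d.head
      | cons m' q => exact ⟨q, by rw [Option.some.inj d.head]⟩
    rw [d.eval a (htr.isIAA.vars_subset_FV.trans (T.FV_subset_branchVars Q)), Atom.subst_id]
    -- A trace that only instantiates would give `l = l'`, which irreflexivity forbids.
    refine (d.trace a b htr).resolve_left ?_
    rintro rfl
    rw [Atom.subst_id] at hll'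
    exact hlt.irrefl _ (hEinst _ (Multiset.mem_of_le (Multiset.sub_le_self _ _) hl')) hll'

theorem IsRoot.not_isBud {T : TreeSet Sp V} (hnorm : T.IsNormalised) {n : V} (h : T.IsRoot n) :
    ¬ T.IsBud n := by
  intro hb
  obtain ⟨m, hm, -⟩ := hnorm.bud_subst n hb
  exact h m hm

/-- Two nested inductions: on the number of nodes reachable from the root, for descents that leave
its SCC, and on the multiset of ranks, for descents that stay inside. -/
theorem not_falsified_of_isRoot [Finite V] {T : TreeSet Sp V} (hM : Sp.IsStandardModel M)
    (hnew : T.EigenvariablesNew) (hnorm : T.IsNormalised)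
    (hSCC : ∀ π : Set V, T.IsSCC π → π.Nontrivial → T.DischargesIHs π) (R : V)
    (hR : T.IsRoot R) (ρ : ℕ → M) : ¬ (T.seq R).Falsified ρ := by
  have hmono : ∀ {a b}, Relation.ReflTransGen T.Child a b → Relation.ReflTransGen T.Arrow a b :=
    fun h => Relation.ReflTransGen.mono (fun _ _ h' => Or.inl h') _ _ h
  induction hk : {m | Relation.ReflTransGen T.Arrow R m}.ncard using Nat.strong_induction_on
    generalizing R ρ with | _ k ih
  let π : Set V := {m | Relation.ReflTransGen T.Arrow R m ∧ Relation.ReflTransGen T.Arrow m R}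
  have hRπ : R ∈ π := ⟨.refl, .refl⟩
  have houter : ∀ Q, T.IsRoot Q → Relation.ReflTransGen T.Arrow R Q → Q ∉ π →
      ∀ ρ : ℕ → M, ¬ (T.seq Q).Falsified ρ := by
    intro Q hQ hRQ hQπ ρ
    refine ih _ ?_ Q hQ ρ rfl
    rw [← hk]
    -- The inclusion is strict because `R` cannot be reached from `Q`; otherwise `Q` would lie in
    -- `π`.
    refine Set.ncard_lt_ncard ⟨fun m hm => hRQ.trans hm, fun hsub => ?_⟩
    exact hQπ ⟨hRQ, hsub Relation.ReflTransGen.refl⟩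
  -- If the companion lies in `π`, the path and the back-link close a cycle through `R`, so the
  -- whole rb-path lies in `π`.
  have hpath : ∀ {Q ρ p H B R' θ} {ρ' : ℕ → M}, Q ∈ π → T.Descent Q ρ p H B R' θ ρ' →
      Relation.ReflTransGen T.Arrow R R' ∧ (R' ∈ π → (∀ n ∈ p, n ∈ π) ∧ B ∈ π) := by
    intro Q ρ p H B R' θ ρ' hQπ d
    have hBR' : Relation.ReflTransGen T.Arrow B R' := .single (.inr d.bud)
    have hRp : ∀ n ∈ p, Relation.ReflTransGen T.Arrow R n :=
      fun n hn => hQπ.1.trans (hmono (d.between n hn).1)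
    have hH := List.mem_of_getLast? d.last
    have hRB := (hRp H hH).trans (hmono (d.between H hH).2)
    exact ⟨hRB.trans hBR', fun hR'π => ⟨fun n hn =>
      ⟨hRp n hn, (hmono (d.between n hn).2).trans (hBR'.trans hR'π.2)⟩, hRB, hBR'.trans hR'π.2⟩⟩
  by_cases hπ : π.Nontrivial
  · obtain ⟨lt, A, hlt, hA, hder⟩ := hSCC π ⟨R, rfl⟩ hπ
    -- All roots of `π` are treated at once, since a companion may be the root of another tree.
    suffices hinner : ∀ (μ : Multiset Ordinal.{max v w}) (Q : V) (ρ : ℕ → M), T.IsRoot Q → Q ∈ π →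
        measureRank Sp A (T.seq Q) ρ = μ → ¬ (T.seq Q).Falsified ρ from
      hinner _ R ρ hR hRπ rfl
    have hwf := Multiset.wellFounded_isDershowitzMannaLT (α := Ordinal.{max v w})
    intro μ
    induction μ using hwf.induction with | _ μ ihμ
    rintro Q ρ hQ hQπ rfl hf
    obtain ⟨p, H, B, R', θ, ρ', d⟩ :=
      exists_descent hM hnew hnorm Q (hQ.not_isBud hnorm) ρ hf
    have hR' := hnorm.companion_root B R' d.bud
    have hf' := d.falsified
    rw [d.seq_last, Sequent.falsified_subst] at hf'
    obtain ⟨hRR', hin⟩ := hpath hQπ d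
    by_cases hR'π : R' ∈ π
    · obtain ⟨hp, hB⟩ := hin hR'π
      exact ihμ _ (d.measureRank_lt hlt hA hQ hQπ hR' hR'π
        (hder p Q H B ⟨d.head, d.last, hQ, ⟨R', d.bud⟩, d.chain⟩ hp hB)) R' _ hR' hR'π rfl hf'
    · exact houter R' hR' hRR' hR'π _ hf'
  · intro hf
    obtain ⟨p, H, B, R', θ, ρ', d⟩ :=
      exists_descent hM hnew hnorm R (hR.not_isBud hnorm) ρ hf
    have hf' := d.falsified
    rw [d.seq_last, Sequent.falsified_subst] at hf'
    obtain ⟨hRR', hin⟩ := hpath hRπ d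
    refine houter R' (hnorm.companion_root B R' d.bud) hRR' (fun hR'π => hπ ?_) _ hf'
    refine ⟨R, hRπ, B, (hin hR'π).2, ?_⟩
    -- A bud has a parent and a root has none, so a return to `π` would give it the two distinct
    -- nodes `R` and `B`.
    rintro rfl
    exact hR H d.child

end TreeSet

end CLKID

/-- Soundness: the root sequents of a normalised pre-proof tree-set, all of whose non-singleton
strongly connected components discharge their induction hypotheses, are true in every standard
model. -/
theorem theorem1 {L : FirstOrder.Language.{u, v}} (Sp : CLKID.Spec L)
    {V : Type x} [Finite V] (T : CLKID.TreeSet Sp V)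
    (hnew : T.EigenvariablesNew) (hnorm : T.IsNormalised)
    (hSCC : ∀ π : Set V, T.IsSCC π → π.Nontrivial → T.DischargesIHs π)
    (M : Type w) [L.Structure M] (hM : Sp.IsStandardModel M)
    (N : V) (hN : T.IsRoot N) : (T.seq N).IsTrue M :=
  CLKID.Sequent.isTrue_of_forall_not_falsified
    (CLKID.TreeSet.not_falsified_of_isRoot hM hnew hnorm hSCC N hN)
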